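/- Let $(W,\Sigma)$ be a Coxeter system ($\Sigma$ possibly infinite), with Coxeter matrix $(m_{s,t})_{s,t\in\Sigma}$ and word length $\ell$ with respect to $\Sigma$. Let $\mathrm{Der}(W,\Sigma)$ be the set $W$ equipped with the distinguished element $1$ and the partial product $\bullet$ such that $f\bullet g$ is defined if and only if $\ell(fg)=\ell(f)+\ell(g)$, in which case $f\bullet g=fg$. This is a germ: $1\bullet f=f=f\bullet 1$ for all $f$, and, if $f\bullet g$ and $g\bullet h$ are defined, then $(f\bullet g)\bullet h$ is defined if and only if $f\bullet(g\bullet h)$ is, in which case they are equal. Then: (1) $\mathrm{Der}(W,\Sigma)$ is a Garside germ, that is, there exist a left-cancellative monoid $C$ and an injection $\iota:W\to C$ with $\iota(1)=1$ such that, for all $f,g,h\in W$, one has $f\bullet g=h$ (with $f\bullet g$ defined) if and only if $\iota(f)\iota(g)=\iota(h)$, and such that $S=\iota(W)$ is a full Garside family in $C$. Here $S$ is *full* if $1\in S$ and every right-divisor in $C$ of an element of $S$ lies in $S$; and $S$ is a *Garside family* if every element of $C$ can be written as a product $g_1\cdots g_q$ with $q\ge 0$ and all $g_i\in SC^\times\cup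 C^\times$ (where $C^\times$ is the set of invertible elements of $C$) such that, for all $1\le i<q$, $h\in S$ and $f\in C$, if $h$ left-divides $fg_ig_{i+1}$ then $h$ left-divides $fg_i$. (2) The monoid generated by $\mathrm{Der}(W,\Sigma)$, that is, the monoid presented by the generators $[w]$, $w\in W$, and the relations $[1]=1$ and $[f][g]=[fg]$ for all $f,g\in W$ with $\ell(fg)=\ell(f)+\ell(g)$, is the Artin–Tits (braid) monoid of $(W,\Sigma)$: there is an isomorphism, mapping $[s]$ to $\sigma_s$ for every $s\in\Sigma$, from this monoid onto the monoid presented by the generators $\sigma_s$, $s\in\Sigma$, and the relations $$\underbrace{\sigma_s\sigma_t\sigma_s\cdots}_{m_{s,t}}=\underbrace{\sigma_t\sigma_s\sigma_t\cdots}_{m_{s,t}}\qquad(s\neq t,\ m_{s,t}<\infty).$$ -/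

import Mathlib

/-! ### Garside families in a left-cancellative monoid

In a monoid, `a ∣ b` means `∃ c, b = a * c`, i.e. `a` is a left-divisor of `b`. -/

section GarsideFamily

variable {C : Type*} [Monoid C]

/-- `S♯ = S Cˣ ∪ Cˣ`, where `Cˣ` is the family of invertible elements. -/
def sharpFamily (S : Set C) : Set C :=
  {g | (∃ s ∈ S, ∃ e, IsUnit e ∧ g = s * e) ∨ IsUnit g}

/-- A path `g₁ | ⋯ | g_q` is `S`-greedy if, for all consecutive entries `g_i`, `g_{i+1}`,
every `h ∈ S` that left-divides `f g_i g_{i+1}` left-divides `f g_i`, for every `f`. -/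
def IsGreedyPath (S : Set C) (l : List C) : Prop :=
  l.IsChain fun g₁ g₂ => ∀ h ∈ S, ∀ f : C, h ∣ f * g₁ * g₂ → h ∣ f * g₁

/-- A path is `S`-normal if it is `S`-greedy with entries in `S♯`. -/
def IsNormalPath (S : Set C) (l : List C) : Prop :=
  IsGreedyPath S l ∧ ∀ g ∈ l, g ∈ sharpFamily S

/-- `S` is a Garside family: every element has an `S`-normal decomposition. (To be used in a
left-cancellative monoid.) -/
def IsGarsideFamily (S : Set C) : Prop :=
  ∀ g : C, ∃ l : List C, IsNormalPath S l ∧ l.prod = g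

/-- `S` is full: it contains the identity and is closed under right-divisor. -/
def IsFullFamily (S : Set C) : Prop :=
  (1 : C) ∈ S ∧ ∀ f g : C, f * g ∈ S → g ∈ S

end GarsideFamily

/-! ### Germs (with one object) -/

/-- A germ with one object: a set `S` with a distinguished element and a partial product
(`mul f g = none` means that the product of `f` and `g` is not defined). The last law says that,
if the products `fg` and `gh` are defined, then `(fg)h` is defined if and only if `f(gh)` is, in
which case they are equal. -/
structure Germ (S : Type*) where
  one : S
  mul : S → S → Option S
  one_mul : ∀ f, mul one f = some f
  mul_one : ∀ f, mul f one = some f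
  assoc : ∀ f g h fg gh, mul f g = some fg → mul g h = some gh → mul fg h = mul f gh

namespace Germ

universe u

variable {S : Type u} (G : Germ S)

/-- The defining relations of the monoid of a germ: the distinguished element is the identity,
and `f | g = f • g` whenever the product `f • g` is defined. -/
inductive Rel : FreeMonoid S → FreeMonoid S → Prop
  | one : Rel (FreeMonoid.of G.one) 1
  | mul (f g h : S) : G.mul f g = some h →
      Rel (FreeMonoid.of f * FreeMonoid.of g) (FreeMonoid.of h)

/-- The monoid generated by a germ. -/
abbrev Mon : Type u := PresentedMonoid G.Rel

/-- `G` is a Garside germ: there is a left-cancellative monoid `C` in which `S` embeds as a full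
Garside family in such a way that the partial product of `G` is the one induced by the product
of `C`. (A category with a full subfamily that has only one object is a monoid.) -/
def IsGarside : Prop :=
  ∃ (C : Type u) (_ : Monoid C) (ι : S → C),
    IsLeftCancelMul C ∧
    Function.Injective ι ∧
    ι G.one = 1 ∧
    (∀ f g h : S, G.mul f g = some h ↔ ι f * ι g = ι h) ∧
    IsFullFamily (Set.range ι) ∧
    IsGarsideFamily (Set.range ι)

end Germ

/-! ### The germ and the monoid of a Coxeter system -/

/-- The germ derived from the whole group `W` of a Coxeter system and its simple reflections:
the product of `f` and `g` is `f * g` if `ℓ (f * g) = ℓ f + ℓ g`, and is undefined otherwise. -/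
noncomputable def CoxeterSystem.derivedGerm {B W : Type*} [Group W] {M : CoxeterMatrix B}
    (cs : CoxeterSystem M W) : Germ W where
  one := 1
  mul f g := if cs.length (f * g) = cs.length f + cs.length g then some (f * g) else none
  one_mul f := by simp
  mul_one f := by simp
  assoc f g h fg gh h₁ h₂ := by
    simp only [Option.ite_none_right_eq_some, Option.some.injEq] at h₁ h₂
    obtain ⟨h₁, rfl⟩ := h₁
    obtain ⟨h₂, rfl⟩ := h₂
    simp only [mul_assoc, h₁, h₂, add_assoc]

/-- The Artin–Tits relations: for `i ≠ j` with `M i j` finite (infinity is encoded by `0`), the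
two alternating words of length `M i j` in the letters `i`, `j` are equal. -/
inductive CoxeterMatrix.ArtinRel {B : Type*} (M : CoxeterMatrix B) :
    FreeMonoid B → FreeMonoid B → Prop
  | braid (i j : B) : i ≠ j → M i j ≠ 0 →
      CoxeterMatrix.ArtinRel M (FreeMonoid.ofList (CoxeterSystem.braidWord M i j))
        (FreeMonoid.ofList (CoxeterSystem.braidWord M j i))

/-- The Artin–Tits (braid) monoid of a Coxeter matrix. -/
abbrev CoxeterMatrix.ArtinMonoid {B : Type*} (M : CoxeterMatrix B) : Type _ :=
  PresentedMonoid M.ArtinRel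

/-! ### The exchange property of Coxeter systems -/

/-! The monoid `Mon` of the derived germ itself serves as `C`. Its projection to `W` makes `toMon`
injective, and projection and length together recover the partial product. The crux is
`exists_greatest_prefix`: the prefixes `h` of `v` with `w * h` reduced have a greatest element. This
is a confluence argument. If `u * s_i` and `u * s_j` are both such prefixes, then `w * u` has
neither `i` nor `j` as a right descent, so it multiplies reducedly with every element of the
parabolic subgroup of `{i, j}`, which supplies a common upper bound. The parabolic decompositions
used here come from the exchange property, itself derived from an action of `W` by signed
conjugations.

Absorbing greatest prefixes defines an action of the monoid on pairs `(v, z)` (`headTailAction`),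
consistent by `LengthAdd.greatestPrefix_mul`. Acting on `(1, 1)` splits `x` into a head, its
greatest divisor in `W`, and a tail. Left cancellation and fullness are read off from this, and
taking heads repeatedly yields normal decompositions, greedy because the head of `x * y` depends
only on `x` and the head of `y`.

The comparison with the Artin–Tits monoid is Matsumoto's theorem: reduced words of one element agree
modulo braid relations, so `w` has a well-defined class. The map back requires both sides of a braid
relation to be reduced, hence that `s_i s_j` has order exactly `M i j`; the geometric representation
shows this. -/

theorem Function.End.mul_apply_eq {α : Type*} (f g : Function.End α) (x : α) :
    (f * g) x = f (g x) := rfl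

theorem Function.End.one_apply_eq {α : Type*} (x : α) : (1 : Function.End α) x = x := rfl

namespace CoxeterSystem

variable {B W : Type*} [Group W] {M : CoxeterMatrix B} (cs : CoxeterSystem M W)

open scoped Classical in
/-- The signed conjugation of `W × ℤ/2` by the simple reflection `s i`: the sign changes exactly at
`s i`. -/
noncomputable def signedConj (i : B) : Function.End (W × ZMod 2) := fun p =>
  (cs.simple i * p.1 * cs.simple i, p.2 + if p.1 = cs.simple i then 1 else 0)

open scoped Classical in
-- The reflections in the sum form the inversion sequence of the alternating word of length `2 * m`;
-- each factor contributes one of them to the sign.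
theorem signedConj_mul_signedConj_pow_apply (i j : B) (m : ℕ) (t : W) (e : ZMod 2) :
    ((cs.signedConj i * cs.signedConj j) ^ m) (t, e) =
      ((cs.simple i * cs.simple j) ^ m * t * ((cs.simple i * cs.simple j) ^ m)⁻¹,
        e + ∑ k ∈ Finset.range (2 * m),
          if t = (cs.simple j * cs.simple i) ^ k * cs.simple j then 1 else 0) := by
  induction m with
  | zero => simp [Function.End.one_apply_eq]
  | succ m ih =>
    have hconj (k : ℕ) : cs.simple j * (cs.simple i * cs.simple j) ^ k =
        (cs.simple j * cs.simple i) ^ k * cs.simple j := by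
      induction k with
      | zero => simp
      | succ k ih => rw [pow_succ, ← mul_assoc, ih, pow_succ]; simp only [mul_assoc]
    have hinv : ((cs.simple i * cs.simple j) ^ m)⁻¹ = (cs.simple j * cs.simple i) ^ m := by
      rw [← inv_pow]; simp
    have h1 : (cs.simple i * cs.simple j) ^ m * t * ((cs.simple i * cs.simple j) ^ m)⁻¹ =
        cs.simple j ↔ t = (cs.simple j * cs.simple i) ^ (2 * m) * cs.simple j := by
      rw [mul_inv_eq_iff_eq_mul, ← eq_inv_mul_iff_mul_eq, hconj, hinv, ← mul_assoc, ← pow_add,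
        two_mul]
    have h2 : cs.simple j *
        ((cs.simple i * cs.simple j) ^ m * t * ((cs.simple i * cs.simple j) ^ m)⁻¹) *
          cs.simple j = cs.simple i ↔
        t = (cs.simple j * cs.simple i) ^ (2 * m + 1) * cs.simple j := by
      rw [← eq_mul_inv_iff_mul_eq, ← eq_inv_mul_iff_mul_eq, mul_inv_eq_iff_eq_mul,
        ← eq_inv_mul_iff_mul_eq, hinv, inv_simple]
      rw [show cs.simple j * (cs.simple i * cs.simple j) * (cs.simple i * cs.simple j) ^ m =
        cs.simple j * (cs.simple i * cs.simple j) ^ (m + 1) by rw [mul_assoc, ← pow_succ'], hconj,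
        ← mul_assoc, ← pow_add, two_mul, add_assoc]
    rw [pow_succ', Function.End.mul_apply_eq, ih, mul_add, mul_one,
      Finset.sum_range_succ, Finset.sum_range_succ]
    simp only [signedConj, Function.End.mul_apply_eq, h1, h2]
    rw [Prod.mk.injEq]
    constructor
    · rw [pow_succ']; simp [mul_assoc]
    · ring

/-- For exponent `M i j` the reflections repeat with period `M i j`, so each is counted twice and
the sign change vanishes mod 2. -/
theorem isLiftable_signedConj : M.IsLiftable cs.signedConj := by
  classical
  intro i j
  funext ⟨t, e⟩
  have hsum : ∑ k ∈ Finset.range (2 * M i j),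
      (if t = (cs.simple j * cs.simple i) ^ k * cs.simple j then (1 : ZMod 2) else 0) = 0 := by
    rw [two_mul, Finset.sum_range_add]
    simp only [pow_add, simple_mul_simple_pow', one_mul]
    exact CharTwo.add_self_eq_zero _
  rw [signedConj_mul_signedConj_pow_apply, hsum]
  simp [Function.End.one_apply_eq]

/-- The action of `W` on `W × ℤ/2` by signed conjugations. -/
noncomputable def signedConjHom : W →* Function.End (W × ZMod 2) :=
  cs.lift ⟨cs.signedConj, cs.isLiftable_signedConj⟩

open scoped Classical in
theorem signedConjHom_wordProd_apply (ω : List B) (t : W) (e : ZMod 2) :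
    cs.signedConjHom (cs.wordProd ω) (t, e) =
      (cs.wordProd ω * t * (cs.wordProd ω)⁻¹, e + ((cs.rightInvSeq ω).count t : ℕ)) := by
  induction ω with
  | nil => simp [Function.End.one_apply_eq]
  | cons i ω ih =>
    have h : (cs.wordProd ω)⁻¹ * cs.simple i * cs.wordProd ω = t ↔
        cs.wordProd ω * t * (cs.wordProd ω)⁻¹ = cs.simple i := by
      rw [mul_inv_eq_iff_eq_mul, mul_assoc, inv_mul_eq_iff_eq_mul, eq_comm]
    rw [wordProd_cons, map_mul, Function.End.mul_apply_eq, ih]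
    rw [signedConjHom, lift_apply_simple]
    simp only [signedConj, rightInvSeq, List.count_cons, beq_iff_eq, h]
    rw [Prod.mk.injEq]
    constructor
    · simp [mul_assoc]
    · push_cast; ring

open scoped Classical in
-- The sign in the action depends only on the group element, not on the chosen word.
theorem natCast_count_rightInvSeq_eq {ω ω' : List B} (h : cs.wordProd ω = cs.wordProd ω') (t : W) :
    ((cs.rightInvSeq ω).count t : ZMod 2) = (cs.rightInvSeq ω').count t := by
  have h₁ := cs.signedConjHom_wordProd_apply ω t 0
  rw [h, signedConjHom_wordProd_apply] at h₁
  simpa using (congrArg Prod.snd h₁).symm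

theorem exists_isReduced_concat_of_isRightDescent {w : W} {i : B} (h : cs.IsRightDescent w i) :
    ∃ ω : List B, cs.IsReduced (ω.concat i) ∧ cs.wordProd (ω.concat i) = w := by
  obtain ⟨ω, hω, hw⟩ := cs.exists_isReduced (w * cs.simple i)
  have hp : cs.wordProd (ω.concat i) = w := by rw [wordProd_concat, ← hw]; simp
  refine ⟨ω, ?_, hp⟩
  rw [isRightDescent_iff] at h
  rw [IsReduced, hp, ← h, hw, hω.eq]
  simp

/-- A reduced word ending in `i` has `s_i` exactly once in its inversion sequence; by parity, every
other word for the same element has it too. -/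
theorem simple_mem_rightInvSeq {ω : List B} {i : B}
    (h : cs.IsRightDescent (cs.wordProd ω) i) : cs.simple i ∈ cs.rightInvSeq ω := by
  classical
  obtain ⟨ω', hω', hp⟩ := cs.exists_isReduced_concat_of_isRightDescent h
  have hmem : cs.simple i ∈ cs.rightInvSeq (ω'.concat i) := by rw [rightInvSeq_concat]; simp
  have hc := cs.natCast_count_rightInvSeq_eq hp (cs.simple i)
  rw [List.count_eq_one_of_mem hω'.nodup_rightInvSeq hmem] at hc
  by_contra hn
  rw [List.count_eq_zero_of_not_mem hn] at hc
  simp at hc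

theorem simple_mem_leftInvSeq {ω : List B} {i : B}
    (h : cs.IsLeftDescent (cs.wordProd ω) i) : cs.simple i ∈ cs.leftInvSeq ω := by
  rw [← isRightDescent_inv_iff, ← wordProd_reverse] at h
  simpa [rightInvSeq_reverse] using cs.simple_mem_rightInvSeq h

/-- The exchange property. -/
theorem exists_simple_mul_wordProd_eq_eraseIdx {ω : List B} {i : B}
    (h : cs.IsLeftDescent (cs.wordProd ω) i) :
    ∃ j < ω.length, cs.simple i * cs.wordProd ω = cs.wordProd (ω.eraseIdx j) := by
  obtain ⟨j, hj, hij⟩ := List.mem_iff_getElem.mp (cs.simple_mem_leftInvSeq h)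
  refine ⟨j, by simpa using hj, ?_⟩
  rw [← getD_leftInvSeq_mul_wordProd, List.getD_eq_getElem _ _ hj, hij]

end CoxeterSystem

/-! ### The geometric representation and the order of a product of two simple reflections -/

open Real in
theorem Polynomial.Chebyshev.sin_mul_eval_S_two_mul_cos (n : ℤ) (θ : ℝ) :
    (Polynomial.Chebyshev.S ℝ n).eval (2 * cos θ) * sin θ = sin ((n + 1) * θ) := by
  have h := congrArg (Polynomial.eval (cos θ)) (Polynomial.Chebyshev.S_comp_two_mul_X ℝ n)
  rw [Polynomial.eval_comp] at h
  simp only [Polynomial.eval_mul, Polynomial.eval_ofNat, Polynomial.eval_X] at h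
  rw [h, Polynomial.Chebyshev.U_real_cos]

namespace CoxeterMatrix

open Real Module

variable {B : Type*} (M : CoxeterMatrix B)

/-- The simple coroot `α ↦ 2⟨α_i, α⟩` of the geometric representation. -/
noncomputable def simpleCoroot (i : B) : Dual ℝ (B →₀ ℝ) :=
  -- If `M i j = 0`, then `π / 0 = 0` gives the coefficient `-2`, the usual value for infinite
  -- order; `M i i = 1` gives `2`.
  Finsupp.linearCombination ℝ fun j => -2 * cos (π / M i j)

theorem simpleCoroot_single (i j : B) :
    M.simpleCoroot i (Finsupp.single j 1) = -2 * cos (π / M i j) := by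
  simp [simpleCoroot]

theorem simpleCoroot_self (i : B) : M.simpleCoroot i (Finsupp.single i 1) = 2 := by
  simp [simpleCoroot_single]

theorem simpleCoroot_mul_simpleCoroot (i j : B) :
    2 * cos (2 * (π / M i j)) = M.simpleCoroot i (Finsupp.single j 1) *
      M.simpleCoroot j (Finsupp.single i 1) - 2 := by
  rw [simpleCoroot_single, simpleCoroot_single, M.symmetric j i, cos_two_mul]
  ring

/-- The simple reflections of the geometric representation. -/
noncomputable def simpleReflection (i : B) : (B →₀ ℝ) ≃ₗ[ℝ] (B →₀ ℝ) :=
  Module.reflection (M.simpleCoroot_self i)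

/-- Treated separately, because `sin (2π / m)` vanishes for `m = 2` and the Chebyshev identity then
carries no information. -/
theorem simpleReflection_mul_pow_of_two {i j : B} (h : M i j = 2) :
    (M.simpleReflection i * M.simpleReflection j) ^ 2 = 1 := by
  have hij : M.simpleCoroot i (Finsupp.single j 1) = 0 := by simp [simpleCoroot_single, h]
  have hji : M.simpleCoroot j (Finsupp.single i 1) = 0 := by
    simp [simpleCoroot_single, M.symmetric j i, h]
  ext1 z
  simp only [pow_two, LinearEquiv.mul_apply, simpleReflection, reflection_apply, map_sub, map_smul,
    hij, hji, simpleCoroot_self, LinearEquiv.coe_one, id]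
  module

theorem sin_two_mul_pi_div_ne_zero {m : ℕ} (hm : 3 ≤ m) : sin (2 * (π / m)) ≠ 0 := by
  have hm' : (3 : ℝ) ≤ m := by exact_mod_cast hm
  have hpos : 0 < π / m := div_pos pi_pos (by linarith)
  have hle : π / m ≤ π / 3 := by gcongr
  exact (sin_pos_of_pos_of_lt_pi (by linarith) (by linarith [pi_pos])).ne'

/-- Put `θ = 2π / m`. Powers of the product are given by Chebyshev polynomials `S` at `2 cos θ`. For
`m = 2k`, `S_{k-1}` vanishes as `sin (kθ) = sin π`. For `m = 2k + 1`, `S_k + S_{k-1}` vanishes as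
`(k + 1)θ = 2π - kθ`. -/
theorem simpleReflection_mul_pow_of_three_le {i j : B} (h : 3 ≤ M i j) :
    (M.simpleReflection i * M.simpleReflection j) ^ M i j = 1 := by
  have hm : (M i j : ℝ) ≠ 0 := by positivity
  have hs := sin_two_mul_pi_div_ne_zero h
  have hS (n : ℤ) := Polynomial.Chebyshev.sin_mul_eval_S_two_mul_cos n (2 * (π / M i j))
  ext1 z
  rw [simpleReflection, simpleReflection, reflection_mul_reflection_pow_apply _ _ _ _ _
    (M.simpleCoroot_mul_simpleCoroot i j)]
  obtain ⟨k, hk⟩ | ⟨k, hk⟩ := Nat.even_or_odd (M i j)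
  · have hk' : (M i j : ℤ) = 2 * k := by omega
    have e1 : ((M i j : ℤ) - 2) / 2 = k - 1 := by omega
    have e2 : ((M i j : ℤ) - 1) / 2 = k - 1 := by omega
    have h0 : (Polynomial.Chebyshev.S ℝ ((k : ℤ) - 1)).eval (2 * cos (2 * (π / M i j))) = 0 := by
      have := hS (k - 1)
      rw [show (((k - 1 : ℤ) : ℝ) + 1) * (2 * (π / M i j)) = π by
        have : (M i j : ℝ) = 2 * k := by exact_mod_cast hk'
        push_cast
        field_simp
        rw [this]; ring, sin_pi] at this
      exact (mul_eq_zero.mp this).resolve_right hs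
    rw [e1, e2, h0]
    simp
  · have hk' : (M i j : ℤ) = 2 * k + 1 := by omega
    have e1 : ((M i j : ℤ) - 2) / 2 = k - 1 := by omega
    have e2 : ((M i j : ℤ) - 1) / 2 = k := by omega
    have e3 : ((M i j : ℤ) - 3) / 2 = k - 1 := by omega
    have e4 : (M i j : ℤ) / 2 = k := by omega
    have h0 : (Polynomial.Chebyshev.S ℝ (k : ℤ)).eval (2 * cos (2 * (π / M i j))) +
        (Polynomial.Chebyshev.S ℝ ((k : ℤ) - 1)).eval (2 * cos (2 * (π / M i j))) = 0 := by
      have h1 := hS k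
      have h2 := hS (k - 1)
      have hkm : (((k : ℤ) : ℝ) + 1) * (2 * (π / M i j)) =
          2 * π - ((((k : ℤ) - 1 : ℤ) : ℝ) + 1) * (2 * (π / M i j)) := by
        have : (M i j : ℝ) = 2 * k + 1 := by exact_mod_cast hk'
        push_cast
        field_simp
        rw [this]; ring
      rw [hkm, sin_two_pi_sub] at h1
      refine (mul_eq_zero.mp ?_).resolve_right hs
      rw [add_mul, h1, h2, neg_add_cancel]
    rw [e1, e2, e3, e4, h0]
    simp

theorem isLiftable_simpleReflection : M.IsLiftable M.simpleReflection := by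
  intro i j
  rcases eq_or_ne i j with rfl | hij
  · ext1 z
    simp [simpleReflection, LinearEquiv.mul_apply, involutive_reflection (M.simpleCoroot_self i) z]
  · have h1 : M i j ≠ 1 := M.off_diagonal i j hij
    rcases lt_trichotomy (M i j) 2 with h | h | h
    · rw [show M i j = 0 by omega, pow_zero]
    · rw [h, simpleReflection_mul_pow_of_two M h]
    · exact M.simpleReflection_mul_pow_of_three_le h

/-- Apply the power to the simple root of `i` and compare coordinates. For `m ≥ 3` this gives
`S_{p-1} = 0` and `S_p = 1` at `2 cos θ`, where `θ = 2π / m`, whence `cos (pθ) = 1`. -/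
theorem dvd_of_simpleReflection_mul_pow_eq_one {i j : B} (hij : i ≠ j) {p : ℕ}
    (hp : (M.simpleReflection i * M.simpleReflection j) ^ p = 1) : M i j ∣ p := by
  have h1 : M i j ≠ 1 := M.off_diagonal i j hij
  have hx := reflection_mul_reflection_pow_apply_self (M.simpleCoroot_self i)
    (M.simpleCoroot_self j) p _ (M.simpleCoroot_mul_simpleCoroot i j)
  change ((M.simpleReflection i * M.simpleReflection j) ^ p) _ = _ at hx
  rw [hp, M.simpleCoroot_single j i, M.symmetric j i] at hx
  have hxi := DFunLike.congr_fun hx i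
  have hxj := DFunLike.congr_fun hx j
  simp [hij, hij.symm] at hxi hxj
  rcases lt_trichotomy (M i j) 2 with h | h | h
  · have h0 : M i j = 0 := by omega
    -- Here the evaluation point is `2`, and `S_{p-1}(2) = p`.
    simpa [h0] using hxj
  · rw [h] at hxi ⊢
    have h2 : 2 * cos (2 * (π / (2 : ℕ))) = -2 := by
      rw [show 2 * (π / (2 : ℕ)) = π by push_cast; ring, cos_pi]; norm_num
    rw [h2, Polynomial.Chebyshev.S_eval_neg_two, Polynomial.Chebyshev.S_eval_neg_two] at hxi
    by_contra hodd
    have hodd' : Odd p := by rwa [← Nat.not_even_iff_odd, even_iff_two_dvd]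
    rw [Int.negOnePow_odd _ (by exact_mod_cast hodd'), Int.negOnePow_even _ (by
      have : Odd (p : ℤ) := by exact_mod_cast hodd'
      exact this.sub_odd odd_one)] at hxi
    push_cast at hxi
    linarith
  · have hs := sin_two_mul_pi_div_ne_zero h
    have hm : (3 : ℝ) ≤ M i j := by exact_mod_cast h
    have hc : cos (π / M i j) ≠ 0 := by
      intro h0
      apply hs
      rw [sin_two_mul, h0, mul_zero]
    have hS (n : ℤ) := Polynomial.Chebyshev.sin_mul_eval_S_two_mul_cos n (2 * (π / M i j))
    have hxj' := hxj.resolve_right hc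
    rw [hxj', add_zero] at hxi
    have hS1 := hS p
    rw [← hxi, one_mul, add_mul, one_mul, sin_add] at hS1
    have hS2 := hS (p - 1)
    rw [hxj', zero_mul] at hS2
    push_cast at hS1 hS2
    rw [sub_add_cancel] at hS2
    rw [← hS2, zero_mul, zero_add] at hS1
    have hcos : cos (p * (2 * (π / M i j))) = 1 := by
      apply mul_right_cancel₀ hs
      rw [one_mul, ← hS1]
    obtain ⟨n, hn⟩ := (cos_eq_one_iff _).mp hcos
    have hpn : (p : ℝ) = M i j * n := by
      have := pi_pos
      field_simp at hn
      linarith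
    have : (p : ℤ) = M i j * n := by exact_mod_cast hpn
    exact_mod_cast Dvd.intro n this.symm

end CoxeterMatrix

theorem CoxeterSystem.dvd_of_simple_mul_simple_pow_eq_one {B W : Type*} [Group W]
    {M : CoxeterMatrix B} (cs : CoxeterSystem M W) {i j : B} (hij : i ≠ j) {p : ℕ}
    (hp : (cs.simple i * cs.simple j) ^ p = 1) : M i j ∣ p := by
  apply M.dvd_of_simpleReflection_mul_pow_eq_one hij
  have h := congrArg (cs.lift ⟨_, M.isLiftable_simpleReflection⟩) hp
  simpa [lift_apply_simple] using h

/-! ### Parabolic decompositions -/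

namespace CoxeterSystem

variable {B W : Type*} [Group W] {M : CoxeterMatrix B} (cs : CoxeterSystem M W)

theorem isReduced_of_cons {i : B} {ω : List B} (h : cs.IsReduced (i :: ω)) : cs.IsReduced ω := by
  simpa using h.drop 1

theorem isReduced_of_concat {i : B} {ω : List B} (h : cs.IsReduced (ω.concat i)) :
    cs.IsReduced ω := by
  simpa using h.take ω.length

theorem isLeftDescent_wordProd_cons {i : B} {ω : List B} (h : cs.IsReduced (i :: ω)) :
    cs.IsLeftDescent (cs.wordProd (i :: ω)) i := by
  rw [IsLeftDescent, h.eq, wordProd_cons, simple_mul_simple_cancel_left,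
    (cs.isReduced_of_cons h).eq]
  simp

/-- Every word can be shortened to a reduced word using only letters of the original word. -/
theorem exists_isReduced_of_forall_mem {I : Set B} (ω : List B) (hω : ∀ x ∈ ω, x ∈ I) :
    ∃ ω' : List B, (∀ x ∈ ω', x ∈ I) ∧ cs.IsReduced ω' ∧ cs.wordProd ω' = cs.wordProd ω := by
  induction ω with
  | nil => exact ⟨[], by simp, by simp [IsReduced], rfl⟩
  | cons i ω ih =>
    obtain ⟨ω', hI, hr, hp⟩ := ih fun x hx => hω x (List.mem_cons_of_mem _ hx)
    by_cases hd : cs.IsLeftDescent (cs.wordProd ω') i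
    · obtain ⟨k, hk, hk'⟩ := cs.exists_simple_mul_wordProd_eq_eraseIdx hd
      refine ⟨ω'.eraseIdx k, fun x hx => hI x (List.mem_of_mem_eraseIdx hx), ?_, ?_⟩
      · rw [isLeftDescent_iff, hr.eq, hk'] at hd
        rw [IsReduced]
        have := List.length_eraseIdx_add_one hk
        omega
      · rw [wordProd_cons, ← hp, hk']
    · refine ⟨i :: ω', ?_, ?_, by rw [wordProd_cons, wordProd_cons, hp]⟩
      · simpa using ⟨hω i (by simp), hI⟩
      · rw [not_isLeftDescent_iff, ← wordProd_cons, hr.eq] at hd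
        rw [IsReduced, hd, List.length_cons]

/-- `b` has minimal length in its right coset `W_I b`. -/
def IsLeftMinimal (I : Set B) (b : W) : Prop :=
  ∀ ω : List B, (∀ x ∈ ω, x ∈ I) → cs.length b ≤ cs.length (cs.wordProd ω * b)

variable {cs} in
-- If prepending `i` lowered the length, exchange would delete a letter of `ω`, against reducedness
-- of `i :: ω`, or a letter of a reduced word of `b`, against minimality in the coset.
theorem IsLeftMinimal.length_mul {I : Set B} {b : W} (hb : cs.IsLeftMinimal I b) {ω : List B}
    (hω : ∀ x ∈ ω, x ∈ I) :
    cs.length (cs.wordProd ω * b) = cs.length (cs.wordProd ω) + cs.length b := by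
  suffices H : ∀ ω : List B, (∀ x ∈ ω, x ∈ I) → cs.IsReduced ω →
      cs.length (cs.wordProd ω * b) = ω.length + cs.length b by
    obtain ⟨ω', hI, hr, hp⟩ := cs.exists_isReduced_of_forall_mem ω hω
    rw [← hp, H ω' hI hr, hr.eq]
  intro ω hω hr
  induction ω with
  | nil => simp
  | cons i ω ih =>
    have hωI : ∀ x ∈ ω, x ∈ I := fun x hx => hω x (List.mem_cons_of_mem _ hx)
    have hr' := cs.isReduced_of_cons hr
    specialize ih hωI hr'
    obtain ⟨β, hβ, rfl⟩ := cs.exists_isReduced b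
    have hd : ¬ cs.IsLeftDescent (cs.wordProd (ω ++ β)) i := by
      intro hd
      obtain ⟨k, hk, hk'⟩ := cs.exists_simple_mul_wordProd_eq_eraseIdx hd
      rcases lt_or_ge k ω.length with hlt | hge
      · rw [List.eraseIdx_append_of_lt_length hlt, wordProd_append, wordProd_append, ← mul_assoc,
          mul_left_inj, ← wordProd_cons] at hk'
        have h1 := cs.length_wordProd_le (ω.eraseIdx k)
        rw [← hk', hr.eq, List.length_cons] at h1
        have := List.length_eraseIdx_add_one hlt
        omega
      · rw [List.eraseIdx_append_of_length_le hge, wordProd_append, wordProd_append] at hk'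
        have hmin := hb (ω.reverse ++ i :: ω) (by
          simpa [or_imp, forall_and] using ⟨hωI, hω i (by simp), hωI⟩)
        rw [wordProd_append, wordProd_reverse, wordProd_cons, mul_assoc, mul_assoc, hk',
          inv_mul_cancel_left, hβ.eq] at hmin
        have h1 := cs.length_wordProd_le (β.eraseIdx (k - ω.length))
        have := List.length_eraseIdx_add_one (l := β) (i := k - ω.length) (by
          rw [List.length_append] at hk; omega)
        omega
    rw [not_isLeftDescent_iff, wordProd_append, ih, ← mul_assoc, ← wordProd_cons] at hd
    rw [hd, List.length_cons]
    omega

theorem exists_isLeftMinimal (I : Set B) (u : W) :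
    ∃ (ω : List B) (b : W), (∀ x ∈ ω, x ∈ I) ∧ cs.IsLeftMinimal I b ∧ u = cs.wordProd ω * b := by
  obtain ⟨b, ⟨ω, hω, rfl⟩, hmin⟩ := (measure cs.length).wf.has_min
    {b | ∃ ω : List B, (∀ x ∈ ω, x ∈ I) ∧ b = cs.wordProd ω * u} ⟨u, [], by simp⟩
  refine ⟨ω.reverse, _, by simpa using hω, fun ω' hω' => not_lt.mp (hmin _ ⟨ω' ++ ω, ?_, ?_⟩), ?_⟩
  · simpa [or_imp, forall_and] using ⟨hω', hω⟩
  · rw [wordProd_append, mul_assoc]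
  · simp

/-- Write `b` as a reduced word in `I` times a minimal element; a first letter of that word would be
a left descent of `b`. -/
theorem isLeftMinimal_of_not_isLeftDescent {I : Set B} {b : W}
    (h : ∀ i ∈ I, ¬ cs.IsLeftDescent b i) : cs.IsLeftMinimal I b := by
  obtain ⟨ω, b', hω, hb', rfl⟩ := cs.exists_isLeftMinimal I b
  obtain ⟨ω', hI, hr, hp⟩ := cs.exists_isReduced_of_forall_mem ω hω
  rw [← hp] at h ⊢
  cases ω' with
  | nil => simpa using hb'
  | cons i ω' =>
    refine absurd ?_ (h i (hI i (by simp)))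
    rw [IsLeftDescent, hb'.length_mul hI, ← mul_assoc, wordProd_cons,
      simple_mul_simple_cancel_left, ← wordProd_cons,
      hb'.length_mul fun x hx => hI x (List.mem_cons_of_mem _ hx), hr.eq,
      (cs.isReduced_of_cons hr).eq]
    simp

/-- The parabolic component of `u` is a prefix of `u` that has the left descents of `u` in `I`. -/
theorem exists_wordProd_prefix (I : Set B) (u : W) :
    ∃ ω : List B, (∀ x ∈ ω, x ∈ I) ∧
      cs.length u = cs.length (cs.wordProd ω) + cs.length ((cs.wordProd ω)⁻¹ * u) ∧
      ∀ i ∈ I, cs.IsLeftDescent u i → cs.IsLeftDescent (cs.wordProd ω) i := by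
  obtain ⟨ω, b, hω, hb, rfl⟩ := cs.exists_isLeftMinimal I u
  refine ⟨ω, hω, by rw [inv_mul_cancel_left, hb.length_mul hω], fun i hi hd => ?_⟩
  rw [IsLeftDescent, ← mul_assoc, ← wordProd_cons, hb.length_mul hω,
    hb.length_mul (by simpa using ⟨hi, hω⟩)] at hd
  rw [IsLeftDescent, ← wordProd_cons]
  omega

theorem length_mul_wordProd_of_not_isRightDescent {I : Set B} {w : W}
    (h : ∀ i ∈ I, ¬ cs.IsRightDescent w i) {ω : List B} (hω : ∀ x ∈ ω, x ∈ I) :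
    cs.length (w * cs.wordProd ω) = cs.length w + cs.length (cs.wordProd ω) := by
  have hmin : cs.IsLeftMinimal I w⁻¹ := cs.isLeftMinimal_of_not_isLeftDescent fun i hi => by
    rw [isLeftDescent_inv_iff]; exact h i hi
  have := hmin.length_mul (ω := ω.reverse) (by simpa using hω)
  rwa [wordProd_reverse, ← mul_inv_rev, length_inv, length_inv, length_inv, add_comm] at this

/-! ### The right weak order -/

/-- The lengths of `a` and `b` add up in the product `a * b`. -/
def LengthAdd (a b : W) : Prop := cs.length (a * b) = cs.length a + cs.length b

/-- The right weak order: `u` is a prefix of `w`. -/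
def WeakLE (u w : W) : Prop := cs.LengthAdd u (u⁻¹ * w)

variable {cs}

/-- Both sides say that the length of `a * b * c` is the sum of the three lengths. -/
theorem lengthAdd_assoc {a b c : W} :
    cs.LengthAdd a b ∧ cs.LengthAdd (a * b) c ↔ cs.LengthAdd b c ∧ cs.LengthAdd a (b * c) := by
  have h₁ := cs.length_mul_le a b
  have h₂ := cs.length_mul_le b c
  have h₃ := cs.length_mul_le (a * b) c
  have h₄ := cs.length_mul_le a (b * c)
  simp only [LengthAdd, mul_assoc] at *
  omega

theorem lengthAdd_one (a : W) : cs.LengthAdd a 1 := by simp [LengthAdd]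

theorem one_lengthAdd (a : W) : cs.LengthAdd 1 a := by simp [LengthAdd]

theorem LengthAdd.weakLE {a b : W} (h : cs.LengthAdd a b) : cs.WeakLE a (a * b) := by
  simpa [WeakLE] using h

theorem weakLE_iff {u w : W} : cs.WeakLE u w ↔ ∃ b, cs.LengthAdd u b ∧ w = u * b :=
  ⟨fun h => ⟨_, h, by simp⟩, by rintro ⟨b, h, rfl⟩; exact h.weakLE⟩

theorem one_weakLE (w : W) : cs.WeakLE 1 w := one_lengthAdd _

theorem weakLE_refl (w : W) : cs.WeakLE w w := by simp [WeakLE, lengthAdd_one]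

theorem WeakLE.trans {u v w : W} (huv : cs.WeakLE u v) (hvw : cs.WeakLE v w) : cs.WeakLE u w := by
  obtain ⟨b, hb, rfl⟩ := weakLE_iff.mp huv
  obtain ⟨c, hc, rfl⟩ := weakLE_iff.mp hvw
  rw [mul_assoc]
  exact (lengthAdd_assoc.mp ⟨hb, hc⟩).2.weakLE

theorem WeakLE.length_le {u v : W} (h : cs.WeakLE u v) : cs.length u ≤ cs.length v := by
  rw [WeakLE, LengthAdd, mul_inv_cancel_left] at h
  omega

theorem WeakLE.eq_of_length_le {u v : W} (h : cs.WeakLE u v) (hl : cs.length v ≤ cs.length u) :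
    u = v := by
  rw [WeakLE, LengthAdd, mul_inv_cancel_left] at h
  have : cs.length (u⁻¹ * v) = 0 := by omega
  rwa [length_eq_zero_iff, inv_mul_eq_one] at this

theorem WeakLE.antisymm {u v : W} (h : cs.WeakLE u v) (h' : cs.WeakLE v u) : u = v :=
  h.eq_of_length_le h'.length_le

theorem LengthAdd.weakLE_mul_iff {a b c : W} (h : cs.LengthAdd a c) :
    cs.WeakLE b c ↔ cs.LengthAdd a b ∧ cs.WeakLE (a * b) (a * c) := by
  have := lengthAdd_assoc (cs := cs) (a := a) (b := b) (c := b⁻¹ * c)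
  simp only [mul_inv_cancel_left, h, and_true] at this
  rw [WeakLE, ← this, WeakLE]
  simp [mul_assoc]

theorem LengthAdd.of_weakLE {a b c : W} (h : cs.LengthAdd a c) (hbc : cs.WeakLE b c) :
    cs.LengthAdd a b :=
  (h.weakLE_mul_iff.mp hbc).1

theorem lengthAdd_simple_iff {w : W} {i : B} :
    cs.LengthAdd w (cs.simple i) ↔ ¬ cs.IsRightDescent w i := by
  rw [not_isRightDescent_iff, LengthAdd, length_simple]

theorem simple_weakLE_iff {w : W} {i : B} :
    cs.WeakLE (cs.simple i) w ↔ cs.IsLeftDescent w i := by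
  rw [isLeftDescent_iff, WeakLE, LengthAdd, mul_inv_cancel_left, inv_simple, length_simple]
  omega

theorem WeakLE.exists_mul_simple {u x : W} (h : cs.WeakLE u x) (hne : u ≠ x) :
    ∃ i, cs.LengthAdd u (cs.simple i) ∧ cs.WeakLE (u * cs.simple i) x := by
  obtain ⟨b, hb, rfl⟩ := weakLE_iff.mp h
  obtain ⟨i, hi⟩ := cs.exists_leftDescent_of_ne_one (w := b) (by rintro rfl; simp at hne)
  exact ⟨i, hb.weakLE_mul_iff.mp (simple_weakLE_iff.mpr hi)⟩

/-- Two elements covering `u` among the prefixes `h` of `v` with `w * h` reduced have a common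
upper bound among these. -/
theorem exists_weakLE_weakLE {w v u : W} {i j : B}
    (hui : cs.LengthAdd u (cs.simple i)) (huj : cs.LengthAdd u (cs.simple j))
    (hiv : cs.WeakLE (u * cs.simple i) v) (hjv : cs.WeakLE (u * cs.simple j) v)
    (hwi : cs.LengthAdd w (u * cs.simple i)) (hwj : cs.LengthAdd w (u * cs.simple j)) :
    ∃ z, cs.WeakLE z v ∧ cs.LengthAdd w z ∧ cs.WeakLE (u * cs.simple i) z ∧
      cs.WeakLE (u * cs.simple j) z := by
  obtain ⟨b, hb, rfl⟩ := weakLE_iff.mp (hui.weakLE.trans hiv)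
  have hi := simple_weakLE_iff.mp (hb.weakLE_mul_iff.mpr ⟨hui, hiv⟩)
  have hj := simple_weakLE_iff.mp (hb.weakLE_mul_iff.mpr ⟨huj, hjv⟩)
  obtain ⟨ω, hω, hlen, hdesc⟩ := cs.exists_wordProd_prefix {i, j} b
  have hωb : cs.WeakLE (cs.wordProd ω) b := by rw [WeakLE, LengthAdd, mul_inv_cancel_left, hlen]
  obtain ⟨huω, hle⟩ := hb.weakLE_mul_iff.mp hωb
  have hwu := lengthAdd_assoc.mpr ⟨hui, hwi⟩
  have hwu' := lengthAdd_assoc.mpr ⟨huj, hwj⟩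
  -- Neither `i` nor `j` is a right descent of `w * u`, so every word in `i`, `j` can be appended
  -- with lengths adding up.
  have hred : cs.LengthAdd (w * u) (cs.wordProd ω) := by
    apply cs.length_mul_wordProd_of_not_isRightDescent (I := {i, j}) _ hω
    rintro k (rfl | rfl)
    · exact lengthAdd_simple_iff.mp hwu.2
    · exact lengthAdd_simple_iff.mp hwu'.2
  refine ⟨u * cs.wordProd ω, hle, (lengthAdd_assoc.mp ⟨hwu.1, hred⟩).2, ?_, ?_⟩
  · exact (huω.weakLE_mul_iff.mp (simple_weakLE_iff.mpr (hdesc i (by simp) hi))).2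
  · exact (huω.weakLE_mul_iff.mp (simple_weakLE_iff.mpr (hdesc j (by simp) hj))).2

variable (cs)

/-- Among the prefixes `h` of `v` for which the product `w * h` is reduced, there is a greatest
one. -/
theorem exists_greatest_prefix (w v : W) :
    ∃ g, cs.WeakLE g v ∧ cs.LengthAdd w g ∧
      ∀ x, cs.WeakLE x v → cs.LengthAdd w x → cs.WeakLE x g := by
  -- Induction on a bound for the length left between `u` and `v`, restricting to prefixes above
  -- `u`.
  suffices H : ∀ n u, cs.length v ≤ cs.length u + n → cs.WeakLE u v → cs.LengthAdd w u →
      ∃ g, cs.WeakLE g v ∧ cs.LengthAdd w g ∧ cs.WeakLE u g ∧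
        ∀ x, cs.WeakLE x v → cs.LengthAdd w x → cs.WeakLE u x → cs.WeakLE x g by
    obtain ⟨g, h₁, h₂, -, h₃⟩ := H (cs.length v) 1 (by simp) (one_weakLE v) (lengthAdd_one w)
    exact ⟨g, h₁, h₂, fun x hx hx' => h₃ x hx hx' (one_weakLE x)⟩
  intro n
  induction n with
  | zero =>
    intro u hn huv hwu
    obtain rfl := huv.eq_of_length_le (by simpa using hn)
    exact ⟨u, huv, hwu, weakLE_refl u, fun x hx _ _ => hx⟩
  | succ n ih =>
    intro u hn huv hwu
    by_cases hex : ∃ i, cs.LengthAdd u (cs.simple i) ∧ cs.WeakLE (u * cs.simple i) v ∧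
        cs.LengthAdd w (u * cs.simple i)
    · obtain ⟨i, hui, hiv, hwi⟩ := hex
      have key (k : B) (huk : cs.LengthAdd u (cs.simple k)) :
          cs.length v ≤ cs.length (u * cs.simple k) + n := by
        rw [LengthAdd, length_simple] at huk
        omega
      obtain ⟨g, hgv, hwg, hug, hg⟩ := ih _ (key i hui) hiv hwi
      refine ⟨g, hgv, hwg, hui.weakLE.trans hug, fun x hxv hwx hux => ?_⟩
      rcases eq_or_ne u x with rfl | hne
      · exact hui.weakLE.trans hug
      obtain ⟨j, huj, hjx⟩ := hux.exists_mul_simple hne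
      have hjv := hjx.trans hxv
      have hwj := hwx.of_weakLE hjx
      obtain ⟨g', hgv', hwg', hug', hg'⟩ := ih _ (key j huj) hjv hwj
      -- Confluence: `x ≤ g'`, while the common bound `z` satisfies `z ≤ g'` and `z ≤ g`. But `hg'`
      -- only yields the first; `hg` applies to `g'` itself, since `u * s_i ≤ z ≤ g'`.
      obtain ⟨z, hzv, hwz, hiz, hjz⟩ := exists_weakLE_weakLE hui huj hiv hjv hwi hwj
      exact (hg' x hxv hwx hjx).trans (hg g' hgv' hwg' (hiz.trans (hg' z hzv hwz hjz)))
    · refine ⟨u, huv, hwu, weakLE_refl u, fun x hxv hwx hux => ?_⟩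
      rcases eq_or_ne u x with rfl | hne
      · exact weakLE_refl u
      obtain ⟨j, huj, hjx⟩ := hux.exists_mul_simple hne
      exact absurd ⟨j, huj, hjx.trans hxv, hwx.of_weakLE hjx⟩ hex

end CoxeterSystem

/-! ### The monoid generated by the derived germ -/

namespace CoxeterSystem

variable {B W : Type*} [Group W] {M : CoxeterMatrix B} (cs : CoxeterSystem M W)

theorem derivedGerm_mul_eq_some_iff {f g h : W} :
    cs.derivedGerm.mul f g = some h ↔ cs.LengthAdd f g ∧ f * g = h := by
  simp [derivedGerm, LengthAdd]

/-- The image of an element of `W` in the monoid of the derived germ. -/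
def toMon (w : W) : cs.derivedGerm.Mon := PresentedMonoid.of _ w

theorem toMon_one : cs.toMon 1 = 1 := PresentedMonoid.mk_eq_mk_of_rel Germ.Rel.one

variable {cs} in
theorem LengthAdd.toMon_mul {f g : W} (h : cs.LengthAdd f g) :
    cs.toMon (f * g) = cs.toMon f * cs.toMon g :=
  (PresentedMonoid.mk_eq_mk_of_rel
    (Germ.Rel.mul f g (f * g) (cs.derivedGerm_mul_eq_some_iff.mpr ⟨h, rfl⟩))).symm

theorem mon_induction {p : cs.derivedGerm.Mon → Prop} (one : p 1)
    (mul : ∀ w x, p x → p (cs.toMon w * x)) (x : cs.derivedGerm.Mon) : p x := by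
  induction x using PresentedMonoid.inductionOn with
  | h a =>
    induction a using FreeMonoid.inductionOn' with
    | one => exact one
    | of_mul w a ih => rw [map_mul]; exact mul w _ ih

/-- A map on `W` that is multiplicative on reduced products extends to the monoid of the derived
germ. -/
def monLift {N : Type*} [Monoid N] (f : W → N) (h_one : f 1 = 1)
    (h_mul : ∀ a b, cs.LengthAdd a b → f (a * b) = f a * f b) : cs.derivedGerm.Mon →* N :=
  PresentedMonoid.lift f (by
    rintro _ _ (_ | ⟨a, b, c, habc⟩)
    · exact (FreeMonoid.lift_eval_of _ _).trans h_one
    · obtain ⟨hab, rfl⟩ := cs.derivedGerm_mul_eq_some_iff.mp habc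
      simpa using (h_mul a b hab).symm)

/-- The projection of the monoid of the derived germ to `W`. -/
def monProj : cs.derivedGerm.Mon →* W := cs.monLift id rfl fun _ _ _ => rfl

/-- The length function on the monoid of the derived germ. -/
noncomputable def monLength : cs.derivedGerm.Mon →* Multiplicative ℕ :=
  cs.monLift (fun w => Multiplicative.ofAdd (cs.length w)) (by simp) fun a b h => by
    rw [h, ofAdd_add]

@[simp]
theorem monProj_toMon (w : W) : cs.monProj (cs.toMon w) = w := rfl

@[simp]
theorem monLength_toMon (w : W) :
    cs.monLength (cs.toMon w) = Multiplicative.ofAdd (cs.length w) := rfl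

theorem toMon_injective : Function.Injective cs.toMon :=
  Function.LeftInverse.injective cs.monProj_toMon

theorem toMon_mul_eq_toMon_iff {f g h : W} :
    cs.toMon f * cs.toMon g = cs.toMon h ↔ cs.LengthAdd f g ∧ f * g = h := by
  refine ⟨fun e => ?_, fun ⟨hfg, e⟩ => e ▸ hfg.toMon_mul.symm⟩
  have h₁ : f * g = h := by simpa using congrArg cs.monProj e
  have h₂ := congrArg cs.monLength e
  rw [map_mul, monLength_toMon, monLength_toMon, monLength_toMon, ← ofAdd_add] at h₂
  refine ⟨?_, h₁⟩
  rw [LengthAdd, h₁]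
  exact (Multiplicative.ofAdd.injective h₂).symm

/-- The greatest prefix `h` of `v` such that `w * h` is reduced. -/
noncomputable def greatestPrefix (w v : W) : W := (cs.exists_greatest_prefix w v).choose

theorem greatestPrefix_weakLE (w v : W) : cs.WeakLE (cs.greatestPrefix w v) v :=
  (cs.exists_greatest_prefix w v).choose_spec.1

theorem lengthAdd_greatestPrefix (w v : W) : cs.LengthAdd w (cs.greatestPrefix w v) :=
  (cs.exists_greatest_prefix w v).choose_spec.2.1

variable {cs} in
theorem WeakLE.weakLE_greatestPrefix {w v x : W} (hx : cs.WeakLE x v) (hw : cs.LengthAdd w x) :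
    cs.WeakLE x (cs.greatestPrefix w v) :=
  (cs.exists_greatest_prefix w v).choose_spec.2.2 x hx hw

theorem greatestPrefix_one_left (v : W) : cs.greatestPrefix 1 v = v :=
  (cs.greatestPrefix_weakLE 1 v).antisymm ((weakLE_refl v).weakLE_greatestPrefix (one_lengthAdd v))

theorem greatestPrefix_one_right (w : W) : cs.greatestPrefix w 1 = 1 :=
  (cs.greatestPrefix_weakLE w 1).antisymm (one_weakLE _)

variable {cs} in
-- Absorbing first into `b`, then into `a`, takes from `v` the same prefix as absorbing into `a *
-- b`. The left side begins with `b` because `a * b` is reduced; maximality on each side gives the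
-- two inequalities.
theorem LengthAdd.greatestPrefix_mul {a b : W} (hab : cs.LengthAdd a b) (v : W) :
    cs.greatestPrefix a (b * cs.greatestPrefix b v) = b * cs.greatestPrefix (a * b) v := by
  have hab' := lengthAdd_assoc.mp ⟨hab, cs.lengthAdd_greatestPrefix (a * b) v⟩
  apply WeakLE.antisymm (cs := cs)
  · have hb : cs.WeakLE b (cs.greatestPrefix a (b * cs.greatestPrefix b v)) :=
      (cs.lengthAdd_greatestPrefix b v).weakLE.weakLE_greatestPrefix hab
    obtain ⟨c, hbc, hc⟩ := weakLE_iff.mp hb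
    have hle := cs.greatestPrefix_weakLE a (b * cs.greatestPrefix b v)
    have hadd := cs.lengthAdd_greatestPrefix a (b * cs.greatestPrefix b v)
    rw [hc] at hle hadd ⊢
    have hc' := (cs.lengthAdd_greatestPrefix b v).weakLE_mul_iff.mpr ⟨hbc, hle⟩
    have := (hc'.trans (cs.greatestPrefix_weakLE b v)).weakLE_greatestPrefix
      (lengthAdd_assoc.mpr ⟨hbc, hadd⟩).2
    exact (hab'.1.weakLE_mul_iff.mp this).2
  · refine WeakLE.weakLE_greatestPrefix ?_ hab'.2
    exact ((cs.lengthAdd_greatestPrefix b v).weakLE_mul_iff.mp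
      ((cs.greatestPrefix_weakLE _ v).weakLE_greatestPrefix hab'.1)).2

/-- The action of the monoid of the derived germ on pairs `(v, z)`, which stand for the products
`[v] z`: an element of `W` absorbs the greatest possible prefix of `v`. -/
noncomputable def headTailAction : cs.derivedGerm.Mon →* Function.End (W × cs.derivedGerm.Mon) :=
  cs.monLift
    (fun w p => (w * cs.greatestPrefix w p.1,
      cs.toMon ((cs.greatestPrefix w p.1)⁻¹ * p.1) * p.2))
    (by
      funext p
      simp [greatestPrefix_one_left, toMon_one, Function.End.one_apply_eq])
    (by
      intro a b hab
      funext ⟨v, z⟩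
      have hab' := lengthAdd_assoc.mp ⟨hab, cs.lengthAdd_greatestPrefix (a * b) v⟩
      -- What `a * b` absorbs is a prefix of what `b` absorbs, so the remainder of `v` splits as a
      -- reduced product.
      have hle : cs.WeakLE (cs.greatestPrefix (a * b) v) (cs.greatestPrefix b v) :=
        (cs.greatestPrefix_weakLE _ v).weakLE_greatestPrefix hab'.1
      have hadd := (lengthAdd_assoc (cs := cs) (a := cs.greatestPrefix (a * b) v)
        (b := (cs.greatestPrefix (a * b) v)⁻¹ * cs.greatestPrefix b v)
        (c := (cs.greatestPrefix b v)⁻¹ * v)).mp ⟨hle, by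
          rw [mul_inv_cancel_left]; exact cs.greatestPrefix_weakLE b v⟩
      change _ = (a * cs.greatestPrefix a (b * cs.greatestPrefix b v),
        cs.toMon ((cs.greatestPrefix a (b * cs.greatestPrefix b v))⁻¹ *
          (b * cs.greatestPrefix b v)) * (cs.toMon ((cs.greatestPrefix b v)⁻¹ * v) * z))
      rw [hab.greatestPrefix_mul, Prod.mk.injEq]
      refine ⟨mul_assoc _ _ _, ?_⟩
      dsimp only
      rw [← mul_assoc (cs.toMon _), mul_inv_rev, mul_assoc _ b⁻¹, inv_mul_cancel_left,
        ← hadd.1.toMon_mul]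
      simp [mul_assoc])

theorem headTailAction_toMon (w : W) (p : W × cs.derivedGerm.Mon) :
    cs.headTailAction (cs.toMon w) p = (w * cs.greatestPrefix w p.1,
      cs.toMon ((cs.greatestPrefix w p.1)⁻¹ * p.1) * p.2) := rfl

theorem headTailAction_mul (x y : cs.derivedGerm.Mon) (p : W × cs.derivedGerm.Mon) :
    cs.headTailAction (x * y) p = cs.headTailAction x (cs.headTailAction y p) := by
  rw [map_mul, Function.End.mul_apply_eq]

theorem toMon_greatestPrefix_mul (w v : W) :
    cs.toMon (cs.greatestPrefix w v) * cs.toMon ((cs.greatestPrefix w v)⁻¹ * v) = cs.toMon v := by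
  rw [← LengthAdd.toMon_mul (cs.greatestPrefix_weakLE w v), mul_inv_cancel_left]

/-- The action rewrites a factorization without changing the product it represents. -/
theorem toMon_headTailAction_fst_mul_snd (x : cs.derivedGerm.Mon) (p : W × cs.derivedGerm.Mon) :
    cs.toMon (cs.headTailAction x p).1 * (cs.headTailAction x p).2 = x * (cs.toMon p.1 * p.2) := by
  induction x using cs.mon_induction with
  | one => simp [Function.End.one_apply_eq]
  | mul w x ih =>
    rw [headTailAction_mul, headTailAction_toMon, mul_assoc, ← ih]
    dsimp only
    rw [(cs.lengthAdd_greatestPrefix _ _).toMon_mul, mul_assoc (cs.toMon w),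
      ← mul_assoc (cs.toMon (cs.greatestPrefix _ _)),
      toMon_greatestPrefix_mul]

theorem headTailAction_fst_eq (x : cs.derivedGerm.Mon) (v : W) (y z : cs.derivedGerm.Mon) :
    (cs.headTailAction x (v, y)).1 = (cs.headTailAction x (v, z)).1 := by
  induction x using cs.mon_induction with
  | one => simp [Function.End.one_apply_eq]
  | mul w x ih => rw [headTailAction_mul, headTailAction_mul, headTailAction_toMon,
      headTailAction_toMon, ih]

/-- The greatest left-divisor of `x` that lies in `W`. -/
noncomputable def head (x : cs.derivedGerm.Mon) : W := (cs.headTailAction x (1, 1)).1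

/-- The quotient of `x` by its head. -/
noncomputable def tail (x : cs.derivedGerm.Mon) : cs.derivedGerm.Mon :=
  (cs.headTailAction x (1, 1)).2

theorem toMon_head_mul_tail (x : cs.derivedGerm.Mon) : cs.toMon (cs.head x) * cs.tail x = x := by
  have h := cs.toMon_headTailAction_fst_mul_snd x (1, 1)
  rwa [toMon_one, mul_one, mul_one] at h

theorem head_toMon (w : W) : cs.head (cs.toMon w) = w := by
  simp [head, headTailAction_toMon, greatestPrefix_one_right]

/-- The first coordinate of the action never depends on the second, so only the head of `y` matters.
-/
theorem head_mul (x y : cs.derivedGerm.Mon) :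
    cs.head (x * y) = cs.head (x * cs.toMon (cs.head y)) := by
  rw [head, head, headTailAction_mul, headTailAction_mul, ← Prod.mk.eta (p := cs.headTailAction y _),
    ← Prod.mk.eta (p := cs.headTailAction (cs.toMon _) _)]
  change _ = (cs.headTailAction x (cs.head (cs.toMon (cs.head y)), _)).1
  rw [head_toMon]
  exact cs.headTailAction_fst_eq _ _ _ _

theorem head_toMon_mul (w : W) (x : cs.derivedGerm.Mon) :
    cs.head (cs.toMon w * x) = w * cs.greatestPrefix w (cs.head x) := by
  rw [head, headTailAction_mul, headTailAction_toMon, head]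

theorem toMon_dvd_iff {w : W} {x : cs.derivedGerm.Mon} :
    cs.toMon w ∣ x ↔ cs.WeakLE w (cs.head x) := by
  constructor
  · rintro ⟨y, rfl⟩
    rw [head_toMon_mul]
    exact (cs.lengthAdd_greatestPrefix _ _).weakLE
  · intro h
    refine ⟨cs.toMon (w⁻¹ * cs.head x) * cs.tail x, ?_⟩
    rw [← mul_assoc, ← LengthAdd.toMon_mul h, mul_inv_cancel_left, toMon_head_mul_tail]

theorem head_weakLE_head_mul (x y : cs.derivedGerm.Mon) :
    cs.WeakLE (cs.head x) (cs.head (x * y)) := by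
  rw [← toMon_dvd_iff]
  exact Dvd.dvd.mul_right (cs.toMon_dvd_iff.mpr (weakLE_refl _)) y

/-! ### Cancellation, fullness and normal decompositions -/

/-- The action on `[w] x` reveals both the prefix absorbed by `w` (cancel `w` in the group) and the
remainder; their product is `x`. -/
theorem toMon_mul_left_cancel {w : W} {x y : cs.derivedGerm.Mon}
    (h : cs.toMon w * x = cs.toMon w * y) : x = y := by
  have h' := congrArg (fun z => cs.headTailAction z (1, 1)) h
  simp only [headTailAction_mul, headTailAction_toMon, Prod.mk.injEq, mul_right_inj] at h'
  change cs.greatestPrefix w (cs.head x) = cs.greatestPrefix w (cs.head y) ∧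
    cs.toMon ((cs.greatestPrefix w (cs.head x))⁻¹ * cs.head x) * cs.tail x =
      cs.toMon ((cs.greatestPrefix w (cs.head y))⁻¹ * cs.head y) * cs.tail y at h'
  rw [← cs.toMon_head_mul_tail x, ← cs.toMon_head_mul_tail y,
    ← cs.toMon_greatestPrefix_mul w (cs.head x), ← cs.toMon_greatestPrefix_mul w (cs.head y),
    mul_assoc, mul_assoc, h'.2, h'.1]

theorem isLeftCancelMul_mon : IsLeftCancelMul cs.derivedGerm.Mon where
  mul_left_cancel x := by
    induction x using cs.mon_induction with
    | one => intro y z h; simpa using h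
    | mul w x ih =>
      intro y z h
      simp only [mul_assoc] at h
      exact ih (cs.toMon_mul_left_cancel h)

/-- If `[v]` divides `[w]`, then `v` is a prefix of `w`, and cancelling it leaves an element of `W`;
the left factor is removed generator by generator. -/
theorem isFullFamily_range_toMon : IsFullFamily (Set.range cs.toMon) := by
  refine ⟨⟨1, cs.toMon_one⟩, fun f => ?_⟩
  induction f using cs.mon_induction with
  | one => simp
  | mul v x ih =>
    rintro g ⟨w, hw⟩
    apply ih
    have hd : cs.WeakLE v w := by
      rw [← cs.head_toMon w, ← toMon_dvd_iff, hw, mul_assoc]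
      exact dvd_mul_right _ _
    refine ⟨v⁻¹ * w, cs.toMon_mul_left_cancel (w := v) ?_⟩
    rw [← LengthAdd.toMon_mul hd, mul_inv_cancel_left, hw, mul_assoc]

/-- The head of a product of a head by a further left-divisor of the tail is unchanged. -/
theorem head_toMon_head_mul {x y z : cs.derivedGerm.Mon} (h : cs.tail x = y * z) :
    cs.head (cs.toMon (cs.head x) * y) = cs.head x := by
  apply WeakLE.antisymm (cs := cs)
  · conv_rhs => rw [← cs.toMon_head_mul_tail x, h, ← mul_assoc]
    exact cs.head_weakLE_head_mul _ _
  · rw [← toMon_dvd_iff]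
    exact dvd_mul_right _ _

theorem head_ne_one {x : cs.derivedGerm.Mon} (hx : x ≠ 1) : cs.head x ≠ 1 := by
  induction x using cs.mon_induction with
  | one => exact absurd rfl hx
  | mul w x ih =>
    intro h
    have hw : cs.WeakLE w 1 := by
      rw [← h, ← toMon_dvd_iff]
      exact dvd_mul_right _ _
    obtain rfl := hw.antisymm (one_weakLE w)
    rw [toMon_one, one_mul] at hx h
    exact ih hx h

theorem isGarsideFamily_range_toMon : IsGarsideFamily (Set.range cs.toMon) := by
  suffices H : ∀ n x, (cs.monLength x).toAdd ≤ n →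
      ∃ l : List cs.derivedGerm.Mon, IsNormalPath (Set.range cs.toMon) l ∧ l.prod = x from
    fun x => H _ x le_rfl
  intro n
  induction n with
  | zero =>
    intro x hx
    refine ⟨[], ⟨List.isChain_nil, by simp⟩, ?_⟩
    by_contra hne
    have h := congrArg (fun z => (cs.monLength z).toAdd) (cs.toMon_head_mul_tail x)
    simp only [map_mul, toAdd_mul, monLength_toMon, toAdd_ofAdd] at h
    exact cs.head_ne_one (fun h => hne h.symm) (cs.length_eq_zero_iff.mp (by omega))
  | succ n ih =>
    intro x hx
    rcases eq_or_ne x 1 with rfl | hne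
    · exact ⟨[], ⟨List.isChain_nil, by simp⟩, rfl⟩
    have h := congrArg (fun z => (cs.monLength z).toAdd) (cs.toMon_head_mul_tail x)
    simp only [map_mul, toAdd_mul, monLength_toMon, toAdd_ofAdd] at h
    have hpos : cs.length (cs.head x) ≠ 0 := fun h0 =>
      cs.head_ne_one hne (cs.length_eq_zero_iff.mp h0)
    obtain ⟨l, ⟨hg, hS⟩, hl⟩ := ih (cs.tail x) (by omega)
    refine ⟨cs.toMon (cs.head x) :: l, ⟨?_, ?_⟩, by rw [List.prod_cons, hl, toMon_head_mul_tail]⟩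
    · cases l with
      | nil => exact List.isChain_singleton _
      | cons y l =>
        refine List.isChain_cons_cons.mpr ⟨?_, hg⟩
        rintro _ ⟨w, rfl⟩ f hdvd
        rw [List.prod_cons] at hl
        rw [toMon_dvd_iff] at hdvd ⊢
        -- Greediness: replacing `[head x] * y` by its head, which is `head x`, does not change the
        -- head of the product with `f`.
        rwa [mul_assoc, head_mul, cs.head_toMon_head_mul hl.symm] at hdvd
    · intro g hgl
      rcases List.mem_cons.mp hgl with rfl | hgl
      · exact Or.inl ⟨_, ⟨_, rfl⟩, 1, isUnit_one, (mul_one _).symm⟩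
      · exact hS g hgl

theorem isGarside_derivedGerm : cs.derivedGerm.IsGarside :=
  ⟨cs.derivedGerm.Mon, inferInstance, cs.toMon, cs.isLeftCancelMul_mon, cs.toMon_injective,
    cs.toMon_one, fun f g h => by rw [derivedGerm_mul_eq_some_iff, toMon_mul_eq_toMon_iff],
    cs.isFullFamily_range_toMon, cs.isGarsideFamily_range_toMon⟩

end CoxeterSystem

/-! ### Matsumoto's theorem -/

namespace CoxeterSystem

variable {B W : Type*} [Group W] {M : CoxeterMatrix B} (cs : CoxeterSystem M W)

theorem eq_alternatingWord_of_isReduced {i j : B} {ω : List B} (hω : ∀ x ∈ ω, x ∈ ({i, j} : Set B))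
    (hr : cs.IsReduced ω) :
    ω = alternatingWord i j ω.length ∨ ω = alternatingWord j i ω.length := by
  have step (i j : B) (ω : List B) (hr : cs.IsReduced (ω.concat j))
      (h : ω = alternatingWord i j ω.length ∨ ω = alternatingWord j i ω.length) :
      ω.concat j = alternatingWord i j (ω.concat j).length := by
    rw [List.length_concat, alternatingWord_succ]
    rcases h with h | h
    · cases hn : ω.length with
      | zero => rw [List.length_eq_zero_iff.mp hn]; rfl
      | succ n =>
        rw [hn, alternatingWord_succ] at h
        have h1 := hr.eq
        rw [h, wordProd_concat, wordProd_concat, simple_mul_simple_cancel_right] at h1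
        have h2 := cs.length_wordProd_le (alternatingWord j i n)
        simp only [List.length_concat] at h1
        omega
    · rw [← h]
  induction ω using List.reverseRecOn with
  | nil => simp [alternatingWord]
  | append_singleton ω x ih =>
    rw [← List.concat_eq_append] at hr hω ⊢
    have ih' := ih (fun y hy => hω y (by simp [hy])) (cs.isReduced_of_concat hr)
    rcases hω x (by simp) with rfl | rfl
    · exact Or.inr (step _ _ _ hr ih'.symm)
    · exact Or.inl (step _ _ _ hr ih')

theorem simple_mul_simple_pow_of_wordProd_eq {i j : B} {p : ℕ}
    (h : cs.wordProd (alternatingWord i j p) = cs.wordProd (alternatingWord j i p)) :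
    (cs.simple i * cs.simple j) ^ p = 1 := by
  rw [prod_alternatingWord_eq_mul_pow, prod_alternatingWord_eq_mul_pow] at h
  have hinv (k : ℕ) : (cs.simple j * cs.simple i) ^ k = ((cs.simple i * cs.simple j) ^ k)⁻¹ := by
    rw [← inv_pow]; simp
  rw [hinv] at h
  obtain ⟨k, rfl | rfl⟩ := Nat.even_or_odd' p
  · simp only [even_two, Even.mul_right, if_true, one_mul, Nat.mul_div_cancel_left k two_pos] at h
    rw [two_mul, pow_add]
    nth_rw 1 [h]
    simp
  · have hk : (2 * k + 1) / 2 = k := by omega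
    have hodd : ¬ Even (2 * k + 1) := by simp
    rw [if_neg hodd, if_neg hodd, hk, eq_mul_inv_iff_mul_eq, mul_assoc, ← pow_add,
      ← two_mul] at h
    rw [pow_succ', mul_assoc, h, simple_mul_simple_self]

/-- Two distinct reduced words in `i`, `j` with the same product are the two sides of the braid
relation. -/
theorem eq_braidWord_of_wordProd_eq {i j : B} (hij : i ≠ j) {ω ω' : List B}
    (hω : ∀ x ∈ ω, x ∈ ({i, j} : Set B)) (hω' : ∀ x ∈ ω', x ∈ ({i, j} : Set B))
    (hr : cs.IsReduced ω) (hr' : cs.IsReduced ω') (h : cs.wordProd ω = cs.wordProd ω')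
    (hne : ω ≠ ω') :
    M i j ≠ 0 ∧ ω.length = M i j ∧
      (ω = braidWord M i j ∧ ω' = braidWord M j i ∨ ω = braidWord M j i ∧ ω' = braidWord M i j) := by
  have hlen : ω'.length = ω.length := by rw [← hr.eq, ← hr'.eq, h]
  have key (hp : cs.wordProd (alternatingWord i j ω.length) =
      cs.wordProd (alternatingWord j i ω.length))
      (hrij : cs.IsReduced (alternatingWord i j ω.length)) : M i j ≠ 0 ∧ ω.length = M i j := by
    have hdvd := cs.dvd_of_simple_mul_simple_pow_eq_one hij
      (cs.simple_mul_simple_pow_of_wordProd_eq hp)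
    have hpos : 0 < ω.length := by
      rw [List.length_pos_iff]
      rintro rfl
      exact hne (List.length_eq_zero_iff.mp hlen).symm
    have h0 : M i j ≠ 0 := by
      intro h0
      rw [h0, zero_dvd_iff] at hdvd
      omega
    refine ⟨h0, le_antisymm (not_lt.mp fun hlt => ?_) (Nat.le_of_dvd hpos hdvd)⟩
    exact cs.not_isReduced_alternatingWord i j h0 hlt hrij
  have h₁ := cs.eq_alternatingWord_of_isReduced hω hr
  have h₂ := cs.eq_alternatingWord_of_isReduced hω' hr'
  rw [hlen] at h₂
  rw [braidWord, braidWord, M.symmetric j i]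
  rcases h₁ with h₁ | h₁ <;> rcases h₂ with h₂ | h₂
  · exact absurd (h₁.trans h₂.symm) hne
  · obtain ⟨h0, hl⟩ := key (h₁ ▸ h₂ ▸ h) (h₁ ▸ hr)
    rw [← hl]
    exact ⟨hl ▸ h0, rfl, Or.inl ⟨h₁, h₂⟩⟩
  · obtain ⟨h0, hl⟩ := key (h₁ ▸ h₂ ▸ h.symm) (h₂ ▸ hr')
    rw [← hl]
    exact ⟨hl ▸ h0, rfl, Or.inr ⟨h₁, h₂⟩⟩
  · exact absurd (h₁.trans h₂.symm) hne

theorem mem_alternatingWord {i j x : B} {p : ℕ} (h : x ∈ alternatingWord i j p) :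
    x ∈ ({i, j} : Set B) := by
  induction p generalizing i j with
  | zero => simp [alternatingWord] at h
  | succ p ih =>
    rw [alternatingWord_succ, List.concat_eq_append, List.mem_append, List.mem_singleton] at h
    rcases h with h | rfl
    · rw [Set.pair_comm]; exact ih h
    · simp

/-- If the last letter lowered the length, the shorter alternating word would have a second reduced
expression in `i`, `j`, ending in `j` instead of `i`. That forces its length to be `M i j`, but it
is smaller. -/
theorem isReduced_alternatingWord {i j : B} (hij : i ≠ j) {p : ℕ} (hM : M i j ≠ 0)
    (hp : p ≤ M i j) : cs.IsReduced (alternatingWord i j p) := by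
  induction p generalizing i j with
  | zero => simp [IsReduced, alternatingWord]
  | succ p ih =>
    have hM' := M.symmetric i j
    have hr := ih hij.symm (hM' ▸ hM) (by omega)
    have hword := cs.wordProd_concat j (alternatingWord j i p)
    rw [alternatingWord_succ]
    rcases cs.length_mul_simple (cs.wordProd (alternatingWord j i p)) j with h | h
    · rw [IsReduced, wordProd_concat, h, hr.eq, List.length_concat]
    · exfalso
      obtain ⟨ω, hω, hωr, hωp⟩ := cs.exists_isReduced_of_forall_mem (I := {i, j})
        ((alternatingWord j i p).concat j) fun x hx => by
          rw [← alternatingWord_succ] at hx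
          exact mem_alternatingWord hx
      have hprod : cs.wordProd (ω.concat j) = cs.wordProd (alternatingWord j i p) := by
        rw [wordProd_concat, hωp, wordProd_concat, simple_mul_simple_cancel_right]
      have hlen : (ω.concat j).length = p := by
        rw [List.length_concat, ← hωr.eq, hωp, hword, h, hr.eq, length_alternatingWord]
      have hred : cs.IsReduced (ω.concat j) := by
        rw [IsReduced, hprod, hr.eq, length_alternatingWord, hlen]
      have hne : ω.concat j ≠ alternatingWord j i p := by
        intro he
        cases p with
        | zero => simp at hlen
        | succ p =>
          rw [alternatingWord_succ] at he
          exact hij (by simpa using (congrArg List.getLast? he).symm)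
      have := (cs.eq_braidWord_of_wordProd_eq hij
        (fun x hx => by
          rw [List.concat_eq_append, List.mem_append, List.mem_singleton] at hx
          rcases hx with hx | rfl
          · exact hω x hx
          · simp)
        (fun x hx => by rw [Set.pair_comm]; exact mem_alternatingWord hx) hred hr hprod hne).2.1
      omega

/-- The class of a word in the Artin–Tits monoid. -/
def artinWord (M : CoxeterMatrix B) (ω : List B) : M.ArtinMonoid :=
  PresentedMonoid.mk M.ArtinRel (FreeMonoid.ofList ω)

theorem artinWord_append (ω ω' : List B) :
    artinWord M (ω ++ ω') = artinWord M ω * artinWord M ω' := by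
  rw [artinWord, FreeMonoid.ofList_append, map_mul]; rfl

theorem artinWord_cons (i : B) (ω : List B) :
    artinWord M (i :: ω) = artinWord M [i] * artinWord M ω :=
  artinWord_append [i] ω

theorem artinWord_braidWord {i j : B} (hij : i ≠ j) (hM : M i j ≠ 0) :
    artinWord M (braidWord M i j) = artinWord M (braidWord M j i) :=
  PresentedMonoid.mk_eq_mk_of_rel (.braid i j hij hM)

theorem artinWord_eq_of_mem_pair {i j : B} {ω ω' : List B}
    (hω : ∀ x ∈ ω, x ∈ ({i, j} : Set B)) (hω' : ∀ x ∈ ω', x ∈ ({i, j} : Set B))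
    (hr : cs.IsReduced ω) (hr' : cs.IsReduced ω') (h : cs.wordProd ω = cs.wordProd ω')
    (hij : i ≠ j) : artinWord M ω = artinWord M ω' := by
  rcases eq_or_ne ω ω' with rfl | hne
  · rfl
  obtain ⟨h0, -, ⟨rfl, rfl⟩ | ⟨rfl, rfl⟩⟩ := cs.eq_braidWord_of_wordProd_eq hij hω hω' hr hr' h hne
  · exact artinWord_braidWord hij h0
  · exact (artinWord_braidWord hij h0).symm

theorem exists_isReduced_cons_of_forall_mem {I : Set B} {ω : List B} (hω : ∀ x ∈ ω, x ∈ I)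
    {i : B} (hi : i ∈ I) (hd : cs.IsLeftDescent (cs.wordProd ω) i) :
    ∃ ω' : List B, (∀ x ∈ i :: ω', x ∈ I) ∧ cs.IsReduced (i :: ω') ∧
      cs.wordProd (i :: ω') = cs.wordProd ω := by
  obtain ⟨ω', hI, hr, hp⟩ := cs.exists_isReduced_of_forall_mem (i :: ω)
    (by simpa using ⟨hi, hω⟩)
  have hp' : cs.wordProd (i :: ω') = cs.wordProd ω := by
    rw [wordProd_cons, hp, wordProd_cons, simple_mul_simple_cancel_left]
  refine ⟨ω', by simpa using ⟨hi, hI⟩, ?_, hp'⟩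
  rw [isLeftDescent_iff, ← wordProd_cons, ← hp, hr.eq] at hd
  rw [IsReduced, hp', List.length_cons, hd]

/-- Matsumoto's theorem: two reduced words with the same product in `W` agree in the Artin–Tits
monoid. -/
theorem artinWord_eq_of_isReduced {ω ω' : List B} (hr : cs.IsReduced ω) (hr' : cs.IsReduced ω')
    (h : cs.wordProd ω = cs.wordProd ω') : artinWord M ω = artinWord M ω' := by
  induction hn : ω.length generalizing ω ω' with
  | zero =>
    have hlen : ω'.length = ω.length := by rw [← hr.eq, ← hr'.eq, h]
    rw [List.length_eq_zero_iff.mp hn, List.length_eq_zero_iff.mp (hlen.trans hn)]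
  | succ n ih =>
    have hlen : ω'.length = ω.length := by rw [← hr.eq, ← hr'.eq, h]
    obtain ⟨i, ω, rfl⟩ := List.exists_cons_of_length_eq_add_one hn
    obtain ⟨j, ω', rfl⟩ := List.exists_cons_of_length_eq_add_one (hlen.trans hn)
    have same (k : B) (α β : List B) (hα : cs.IsReduced (k :: α)) (hβ : cs.IsReduced (k :: β))
        (hαβ : cs.wordProd (k :: α) = cs.wordProd (k :: β)) (hl : (k :: α).length = n + 1) :
        artinWord M (k :: α) = artinWord M (k :: β) := by
      rw [artinWord_cons, artinWord_cons k β,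
        ih (cs.isReduced_of_cons hα) (cs.isReduced_of_cons hβ)
          (by simpa [wordProd_cons] using hαβ) (by simpa using hl)]
    rcases eq_or_ne i j with rfl | hij
    · exact same i ω ω' hr hr' h hn
    have hi := cs.isLeftDescent_wordProd_cons hr
    have hj := cs.isLeftDescent_wordProd_cons hr'
    rw [← h] at hj
    -- The `{i, j}`-component has both `i` and `j` as left descents, so it has reduced words with
    -- either first letter; these differ by a braid relation, and the common remainder `δ` completes
    -- both.
    obtain ⟨γ, hγ, hlenγ, hdesc⟩ := cs.exists_wordProd_prefix {i, j} (cs.wordProd (i :: ω))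
    obtain ⟨α, hα, hαr, hαp⟩ :=
      cs.exists_isReduced_cons_of_forall_mem hγ (by simp) (hdesc i (by simp) hi)
    obtain ⟨β, hβ, hβr, hβp⟩ :=
      cs.exists_isReduced_cons_of_forall_mem hγ (by simp) (hdesc j (by simp) hj)
    obtain ⟨δ, hδ, hδp⟩ := cs.exists_isReduced ((cs.wordProd γ)⁻¹ * cs.wordProd (i :: ω))
    have ext (ζ : List B) (hζ : cs.IsReduced ζ) (hζp : cs.wordProd ζ = cs.wordProd γ) :
        cs.IsReduced (ζ ++ δ) ∧ cs.wordProd (ζ ++ δ) = cs.wordProd (i :: ω) := by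
      have hp : cs.wordProd (ζ ++ δ) = cs.wordProd (i :: ω) := by
        rw [wordProd_append, hζp, ← hδp, mul_inv_cancel_left]
      refine ⟨?_, hp⟩
      rw [IsReduced, hp, hlenγ, hδp, hδ.eq, ← hζp, hζ.eq, List.length_append]
    obtain ⟨hαδ, hαδp⟩ := ext _ hαr hαp
    obtain ⟨hβδ, hβδp⟩ := ext _ hβr hβp
    calc artinWord M (i :: ω) = artinWord M (i :: α ++ δ) := same _ _ _ hr hαδ hαδp.symm hn
      _ = artinWord M (j :: β ++ δ) := by
        rw [artinWord_append, artinWord_append,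
          cs.artinWord_eq_of_mem_pair hα hβ hαr hβr (hαp.trans hβp.symm) hij]
      _ = artinWord M (j :: ω') := (same _ _ _ hr' hβδ (h.symm.trans hβδp.symm) (hlen.trans hn)).symm

/-! ### The isomorphism with the Artin–Tits monoid -/

/-- The monoid homomorphism from the monoid of the derived germ to the Artin–Tits monoid that maps
the class of `w` to the class of the reduced words of `w`. -/
noncomputable def monToArtin : cs.derivedGerm.Mon →* M.ArtinMonoid :=
  cs.monLift (fun w => artinWord M (cs.exists_isReduced w).choose)
    (by
      rw [cs.artinWord_eq_of_isReduced (ω' := []) (cs.exists_isReduced 1).choose_spec.1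
        (by simp [IsReduced]) (by simp [← (cs.exists_isReduced 1).choose_spec.2])]
      exact map_one _)
    (by
      intro a b hab
      obtain ⟨ha, ha'⟩ := (cs.exists_isReduced a).choose_spec
      obtain ⟨hb, hb'⟩ := (cs.exists_isReduced b).choose_spec
      obtain ⟨h, h'⟩ := (cs.exists_isReduced (a * b)).choose_spec
      have hp : cs.wordProd ((cs.exists_isReduced a).choose ++ (cs.exists_isReduced b).choose) =
          a * b := by rw [wordProd_append, ← ha', ← hb']
      rw [← artinWord_append]
      refine cs.artinWord_eq_of_isReduced h ?_ (h'.symm.trans hp.symm)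
      rw [IsReduced, hp, hab, List.length_append, ← ha.eq, ← hb.eq, ← ha', ← hb'])

theorem monToArtin_toMon_wordProd {ω : List B} (h : cs.IsReduced ω) :
    cs.monToArtin (cs.toMon (cs.wordProd ω)) = artinWord M ω :=
  have hspec := (cs.exists_isReduced (cs.wordProd ω)).choose_spec
  cs.artinWord_eq_of_isReduced hspec.1 h hspec.2.symm

theorem toMon_wordProd {ω : List B} (h : cs.IsReduced ω) :
    cs.toMon (cs.wordProd ω) = (ω.map fun i => cs.toMon (cs.simple i)).prod := by
  induction ω with
  | nil => simp [toMon_one]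
  | cons i ω ih =>
    have hω := cs.isReduced_of_cons h
    have hadd : cs.LengthAdd (cs.simple i) (cs.wordProd ω) := by
      rw [LengthAdd, ← wordProd_cons, h.eq, hω.eq, length_simple, List.length_cons, add_comm]
    rw [wordProd_cons, hadd.toMon_mul, ih hω, List.map_cons, List.prod_cons]

/-- The monoid homomorphism from the Artin–Tits monoid to the monoid of the derived germ that maps
the generators to the classes of the simple reflections. -/
noncomputable def artinToMon : M.ArtinMonoid →* cs.derivedGerm.Mon :=
  PresentedMonoid.lift (fun i => cs.toMon (cs.simple i)) (by
    rintro _ _ ⟨i, j, hij, hM⟩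
    rw [FreeMonoid.lift_apply, FreeMonoid.lift_apply, FreeMonoid.toList_ofList,
      FreeMonoid.toList_ofList, ← toMon_wordProd, ← toMon_wordProd, wordProd_braidWord_eq]
    · exact cs.isReduced_alternatingWord hij.symm (M.symmetric i j ▸ hM) le_rfl
    · exact cs.isReduced_alternatingWord hij hM le_rfl)

theorem artinToMon_artinWord (ω : List B) :
    cs.artinToMon (artinWord M ω) = (ω.map fun i => cs.toMon (cs.simple i)).prod :=
  FreeMonoid.lift_apply _ _

theorem monToArtin_toMon_simple (i : B) :
    cs.monToArtin (cs.toMon (cs.simple i)) = PresentedMonoid.of M.ArtinRel i := by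
  have h := cs.monToArtin_toMon_wordProd (ω := [i]) (by simp [IsReduced])
  rwa [wordProd_singleton] at h

/-- The monoid of the derived germ is the Artin–Tits monoid. -/
noncomputable def monEquivArtin : cs.derivedGerm.Mon ≃* M.ArtinMonoid :=
  MonoidHom.toMulEquiv cs.monToArtin cs.artinToMon
    (PresentedMonoid.ext _ fun w => by
      obtain ⟨ω, hω, rfl⟩ := cs.exists_isReduced w
      change cs.artinToMon (cs.monToArtin (cs.toMon _)) = cs.toMon _
      rw [monToArtin_toMon_wordProd cs hω, artinToMon_artinWord, toMon_wordProd cs hω])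
    (PresentedMonoid.ext _ fun i => cs.monToArtin_toMon_simple i)

end CoxeterSystem

theorem mainTheorem12 {B W : Type*} [Group W] {M : CoxeterMatrix B} (cs : CoxeterSystem M W) :
    cs.derivedGerm.IsGarside ∧
    ∃ e : cs.derivedGerm.Mon ≃* M.ArtinMonoid,
      ∀ i : B, e (PresentedMonoid.of cs.derivedGerm.Rel (cs.simple i)) =
        PresentedMonoid.of M.ArtinRel i :=
  ⟨cs.isGarside_derivedGerm, cs.monEquivArtin, cs.monToArtin_toMon_simple⟩
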